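/- Let $B>0$ and $m\in\{0,1,2,\dots\}$. For $x\in\mathbb R^2$ with polar coordinates $(r,\varphi)$ put $$\phi_m(x)=\sqrt{\frac{B}{2\pi}}\,\frac{1}{\sqrt{m!}}\Big(\frac{Br^2}{2}\Big)^{m/2}e^{-im\varphi}e^{-Br^2/4},$$ and for $z\in\mathbb R$ let $$V(z)=V_{m,m}(z)=\int_{\mathbb R^2}\int_{\mathbb R^2}\frac{|\phi_m(x)|^2\,|\phi_m(y)|^2}{\sqrt{|x-y|^2+z^2}}\,dx\,dy .$$ Let $N\ge 1$ and let $\psi\in L^2(\mathbb R^N;\mathbb C)$ be normalized, $\int_{\mathbb R^N}|\psi|^2=1$ (no symmetry is assumed). Define its density $$\rho_\psi(x)=\sum_{i=1}^N\int_{\mathbb R^{N-1}}|\psi(x_1,\dots,x_{i-1},x,x_{i+1},\dots,x_N)|^2\,dx_1\cdots dx_{i-1}\,dx_{i+1}\cdots dx_N ,$$ assume $\rho_\psi\in L^2(\mathbb R)$, and define the mean density $\bar\rho_\psi=\frac1N\int_{\mathbb R}\rho_\psi(x)^2\,dx$ and the exchange energy $$\mathrm{Ex}_\psi=\int_{\mathbb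 R^N}\sum_{1\le i<j\le N}V(|x_i-x_j|)\,|\psi(x_1,\dots,x_N)|^2\,dx_1\cdots dx_N-\frac12\int_{\mathbb R^2}\rho_\psi(x)\rho_\psi(y)V(|x-y|)\,dx\,dy .$$ Then the integral defining $V(z)$ converges absolutely for every $z\in\mathbb R$, both integrals defining $\mathrm{Ex}_\psi$ converge absolutely, and $$\mathrm{Ex}_\psi\ \ge\ -16\,N\,\bar\rho_\psi\left(\ln\left[e^3+\frac{B^{1/2}}{\bar\rho_\psi}\right]+2\right).$$ -/

import Mathlib

open MeasureTheory

noncomputable section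

/-- The one-particle density of an `N`-particle wave function `ψ` on `ℝ^N`:
`ρ_ψ(x) = ∑ i, ∫ |ψ(x_1, …, x_{i-1}, x, x_{i+1}, …, x_N)|²`, the `i`-th integral being over the
`N - 1` coordinates `x_j` with `j ≠ i`. -/
def density {N : ℕ} (ψ : (Fin N → ℝ) → ℂ) (x : ℝ) : ℝ :=
  ∑ i : Fin N, ∫ y : {j : Fin N // j ≠ i} → ℝ,
    ‖ψ (fun j => if h : j = i then x else y ⟨j, h⟩)‖ ^ 2

/-- The mean density `N⁻¹ ∫ ρ_ψ²`. -/
def meanDensity {N : ℕ} (ψ : (Fin N → ℝ) → ℂ) : ℝ :=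
  (1 / (N : ℝ)) * ∫ x : ℝ, density ψ x ^ 2

/-- The integrand of `⟨ψ| ∑_{i<j} V(|x_i - x_j|) ψ⟩`. -/
def interactionIntegrand {N : ℕ} (V : ℝ → ℝ) (ψ : (Fin N → ℝ) → ℂ) (x : Fin N → ℝ) : ℝ :=
  (∑ i : Fin N, ∑ j ∈ Finset.Ioi i, V |x i - x j|) * ‖ψ x‖ ^ 2

/-- The integrand of the direct interaction, `ρ_ψ(x) ρ_ψ(y) V(|x - y|)`. -/
def directIntegrand {N : ℕ} (V : ℝ → ℝ) (ψ : (Fin N → ℝ) → ℂ) (p : ℝ × ℝ) : ℝ :=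
  density ψ p.1 * density ψ p.2 * V |p.1 - p.2|

/-- The exchange energy: the interaction energy of `ψ` minus its direct part. -/
def exchangeEnergy {N : ℕ} (V : ℝ → ℝ) (ψ : (Fin N → ℝ) → ℂ) : ℝ :=
  (∫ x : Fin N → ℝ, interactionIntegrand V ψ x) -
    (1 / 2) * ∫ p : ℝ × ℝ, directIntegrand V ψ p

/-- The function in the lowest Landau band with angular momentum `-m`, at field strength `B`.
The plane perpendicular to the field is `ℂ` (as the Euclidean plane, with Lebesgue measure), so the
polar coordinates of `w` are `‖w‖` and `Complex.arg w`. -/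
def landauFunction (B : ℝ) (m : ℕ) (w : ℂ) : ℂ :=
  ((√(B / (2 * Real.pi)) * (1 / √(m.factorial : ℝ)) * (B * ‖w‖ ^ 2 / 2) ^ ((m : ℝ) / 2) : ℝ) : ℂ) *
    Complex.exp (-Complex.I * (m : ℂ) * (Complex.arg w : ℂ)) *
    ((Real.exp (-B * ‖w‖ ^ 2 / 4) : ℝ) : ℂ)

/-- The integrand of the effective potential `V_{m,n}(z)`, on the product of two planes. -/
def landauPotentialIntegrand (B : ℝ) (m n : ℕ) (z : ℝ) (p : ℂ × ℂ) : ℝ :=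
  ‖landauFunction B m p.1‖ ^ 2 * ‖landauFunction B n p.2‖ ^ 2 / √(‖p.1 - p.2‖ ^ 2 + z ^ 2)

/-- The effective one-dimensional Coulomb potential `V_{m,n}(z)`. -/
def landauPotential (B : ℝ) (m n : ℕ) (z : ℝ) : ℝ :=
  ∫ p : ℂ × ℂ, landauPotentialIntegrand B m n z p

end

/-!
Since `1/d = (2/√π) ∫₀^∞ e^{-t²d²} dt`, the effective potential is a superposition of Gaussians
with nonnegative weights, `V(z) = ∫₀^∞ w(t) e^{-t²z²} dt` (`ofReal_landauPotential`), where
`w(t) = (2/√π) ∬ |φ_m(x)|² |φ_m(y)|² e^{-t²|x-y|²} dx dy`. The function `|φ_m|²` has integral `1`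
and is bounded by `B/2π`, whence `w(t) ≤ (2/√π) min(1, B/(2t²))`; in particular `w` is integrable,
`V` is bounded, and all integrals converge.

It remains to compare, for each fixed `t`, the pair energy `A` of the Gaussian `G(z) = e^{-t²z²}` in
the law `|ψ|²` with the self-energy `D = ∬ ρ(x) ρ(y) G(x-y) dx dy` of the density. There are two
bounds on `D - 2A`:

* `D - 2A ≤ N`, because `G` is positive definite and `G(0) = 1`
  (`lintegral_gaussKernel_marginals_le`);
* `D - 2A ≤ D ≤ ∫ G ∫ ρ² = (√π/t) N ρ̄` (`lintegral_gaussKernel_le_sq`).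

The first one is used for `t ≤ ρ̄` and the second one for larger `t`, where it produces the
logarithm on `ρ̄ < t ≤ ρ̄ + √B` and is cut off by the decay of `w` beyond
(`lintegral_landauWeight_mul_min_le`). This gives
`Ex ≥ -N ρ̄ (log (1 + √B/ρ̄) + 2)`, which is stronger than the claim.

The comparison is carried out with extended nonnegative integrals, for which Tonelli's theorem needs
no integrability.
-/

/-! ### The Gaussian kernel -/

/-- The Gaussian kernel `e^{-t²d²}`, as an extended nonnegative number. -/
noncomputable def gaussKernel (t d : ℝ) : ENNReal := ENNReal.ofReal (Real.exp (-t ^ 2 * d ^ 2))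

lemma gaussKernel_zero (t : ℝ) : gaussKernel t 0 = 1 := by simp [gaussKernel]

lemma gaussKernel_neg (t d : ℝ) : gaussKernel t (-d) = gaussKernel t d := by simp [gaussKernel]

lemma gaussKernel_le_one (t d : ℝ) : gaussKernel t d ≤ 1 := by
  rw [gaussKernel, ENNReal.ofReal_le_one, Real.exp_le_one_iff]
  nlinarith [sq_nonneg (t * d)]

@[fun_prop]
lemma Measurable.gaussKernel {α : Type*} [MeasurableSpace α] {f g : α → ℝ} (hf : Measurable f)
    (hg : Measurable g) : Measurable (fun a => _root_.gaussKernel (f a) (g a)) := by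
  unfold _root_.gaussKernel; fun_prop

lemma lintegral_gaussKernel {t : ℝ} (ht : 0 < t) :
    ∫⁻ u, gaussKernel t u = ENNReal.ofReal (√Real.pi / t) := by
  have h : ∫ u : ℝ, Real.exp (-t ^ 2 * u ^ 2) = √Real.pi / t := by
    rw [integral_gaussian, Real.sqrt_div' _ (by positivity), Real.sqrt_sq ht.le]
  rw [← h, ofReal_integral_eq_lintegral_ofReal (integrable_exp_neg_mul_sq (by positivity))
    (Filter.Eventually.of_forall fun u => (Real.exp_pos _).le)]
  rfl

/-- The Gaussian kernel is, up to a constant, the convolution of a Gaussian with itself. -/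
lemma lintegral_gaussKernel_mul (t x y : ℝ) :
    ∫⁻ u, gaussKernel (√2 * t) (x - u) * gaussKernel (√2 * t) (y - u) =
      gaussKernel t (x - y) * ∫⁻ u, gaussKernel (2 * t) u := by
  have key : ∀ u, gaussKernel (√2 * t) (x - u) * gaussKernel (√2 * t) (y - u) =
      gaussKernel t (x - y) * gaussKernel (2 * t) (u - (x + y) / 2) := by
    intro u
    simp only [gaussKernel]
    rw [← ENNReal.ofReal_mul (Real.exp_pos _).le, ← ENNReal.ofReal_mul (Real.exp_pos _).le,
      ← Real.exp_add, ← Real.exp_add, mul_pow, Real.sq_sqrt (by norm_num)]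
    ring_nf
  simp_rw [key]
  rw [lintegral_const_mul _ (by fun_prop), lintegral_sub_right_eq_self (gaussKernel (2 * t))]

lemma ENNReal.two_mul_mul_le_add_sq (a b : ENNReal) : 2 * (a * b) ≤ a ^ 2 + b ^ 2 := by
  wlog h : a ≤ b generalizing a b
  · simpa [mul_comm, add_comm] using this b a (le_of_not_ge h)
  obtain ⟨c, rfl⟩ := exists_add_of_le h
  have : a ^ 2 + (a + c) ^ 2 = 2 * (a * (a + c)) + c ^ 2 := by ring
  rw [this]
  exact le_self_add

/-! ### Two bounds on Gaussian self-energies -/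

/-- Positive definiteness of the Gaussian kernel: for two configurations `x` and `y` of points, the
form `∑ (G(xᵢ - xⱼ) + G(yᵢ - yⱼ) - 2 G(xᵢ - yⱼ))` is nonnegative. -/
lemma two_mul_sum_gaussKernel_le {N : ℕ} {t : ℝ} (ht : 0 < t) (x y : Fin N → ℝ) :
    2 * ∑ i, ∑ j, gaussKernel t (x i - y j) ≤
      (∑ i, ∑ j, gaussKernel t (x i - x j)) + ∑ i, ∑ j, gaussKernel t (y i - y j) := by
  set K := ∫⁻ u, gaussKernel (2 * t) u with hK
  have hKv : K = ENNReal.ofReal (√Real.pi / (2 * t)) := lintegral_gaussKernel (by positivity)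
  have hK0 : K ≠ 0 := by rw [hKv]; simpa using by positivity
  have hKt : K ≠ ⊤ := by rw [hKv]; exact ENNReal.ofReal_ne_top
  -- writing `G` as a convolution turns the double sums into integrals of products of sums
  have hS : ∀ a b : Fin N → ℝ, (∑ i, ∑ j, gaussKernel t (a i - b j)) * K =
      ∫⁻ u, (∑ i, gaussKernel (√2 * t) (a i - u)) * ∑ j, gaussKernel (√2 * t) (b j - u) := by
    intro a b
    simp_rw [Finset.sum_mul_sum]
    rw [lintegral_finsetSum _ (fun i _ => by fun_prop), Finset.sum_mul]
    refine Finset.sum_congr rfl fun i _ => ?_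
    rw [lintegral_finsetSum _ (fun i _ => by fun_prop), Finset.sum_mul]
    exact Finset.sum_congr rfl fun j _ => (lintegral_gaussKernel_mul t _ _).symm
  rw [← ENNReal.mul_le_mul_iff_left hK0 hKt, mul_assoc, hS, add_mul, hS, hS,
    ← lintegral_add_left (by fun_prop), ← lintegral_const_mul _ (by fun_prop)]
  refine lintegral_mono fun u => ?_
  rw [← sq, ← sq]
  exact ENNReal.two_mul_mul_le_add_sq _ _

/-- The sum of all pair interactions of a configuration, written through unordered pairs. -/
lemma sum_gaussKernel_eq {N : ℕ} (t : ℝ) (x : Fin N → ℝ) :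
    ∑ i, ∑ j, gaussKernel t (x i - x j) =
      2 * (∑ i, ∑ j ∈ Finset.Ioi i, gaussKernel t (x i - x j)) + N := by
  have h := Finset.sum_sum_Ioi_add_eq_sum_sum_off_diag (fun i j => gaussKernel t (x j - x i))
  have h1 : ∀ i, ∑ j, gaussKernel t (x i - x j) =
      (∑ j ∈ {i}ᶜ, gaussKernel t (x i - x j)) + 1 := by
    intro i
    rw [← Finset.sum_compl_add_sum {i}]
    simp [gaussKernel_zero]
  simp_rw [h1, Finset.sum_add_distrib]
  rw [← h]
  simp_rw [Finset.sum_add_distrib, two_mul]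
  congr 2
  · refine Finset.sum_congr rfl fun i _ => Finset.sum_congr rfl fun j _ => ?_
    rw [← gaussKernel_neg, neg_sub]
  · simp

/-- For a random configuration with law `μ` and intensity measure `∑ᵢ μ ∘ xᵢ⁻¹`, the Gaussian
self-energy of the intensity exceeds twice the expected pair energy by at most `N`. -/
lemma lintegral_gaussKernel_marginals_le {N : ℕ} {t : ℝ} (ht : 0 < t) (μ : Measure (Fin N → ℝ))
    [IsProbabilityMeasure μ] {σ : Measure ℝ} (hσ : σ = ∑ i, μ.map (fun x => x i)) :
    ∫⁻ a, ∫⁻ b, gaussKernel t (a - b) ∂σ ∂σ ≤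
      2 * (∫⁻ x, ∑ i, ∑ j ∈ Finset.Ioi i, gaussKernel t (x i - x j) ∂μ) + N := by
  have hm : ∀ f : ℝ → ENNReal, Measurable f → ∫⁻ a, f a ∂σ = ∫⁻ x, ∑ i, f (x i) ∂μ := by
    intro f hf
    rw [hσ, lintegral_finsetSum_measure, lintegral_finsetSum _ (fun i _ => by fun_prop)]
    exact Finset.sum_congr rfl fun i _ => lintegral_map hf (by fun_prop)
  -- the self-energy is the mean mutual energy of two independent copies of the configuration
  have hD : ∫⁻ a, ∫⁻ b, gaussKernel t (a - b) ∂σ ∂σ =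
      ∫⁻ x, ∫⁻ y, ∑ i, ∑ j, gaussKernel t (x i - y j) ∂μ ∂μ := by
    have h1 : ∀ a, ∫⁻ b, gaussKernel t (a - b) ∂σ = ∫⁻ y, ∑ j, gaussKernel t (a - y j) ∂μ :=
      fun a => hm _ (by fun_prop)
    simp_rw [h1]
    rw [hm _ (Measurable.lintegral_prod_right'
      (f := fun p : ℝ × (Fin N → ℝ) => ∑ j, gaussKernel t (p.1 - p.2 j)) (by fun_prop))]
    refine lintegral_congr fun x => ?_
    rw [lintegral_finsetSum _ (fun i _ => by fun_prop)]
  have h2 : 2 * ∫⁻ a, ∫⁻ b, gaussKernel t (a - b) ∂σ ∂σ ≤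
      2 * ∫⁻ x, ∑ i, ∑ j, gaussKernel t (x i - x j) ∂μ := by
    rw [hD, ← lintegral_const_mul _ (Measurable.lintegral_prod_right' (f := fun p :
      (Fin N → ℝ) × (Fin N → ℝ) => ∑ i, ∑ j, gaussKernel t (p.1 i - p.2 j)) (by fun_prop))]
    calc _ ≤ ∫⁻ x, ((∑ i, ∑ j, gaussKernel t (x i - x j)) +
          ∫⁻ y, ∑ i, ∑ j, gaussKernel t (y i - y j) ∂μ) ∂μ := by
          refine lintegral_mono fun x => ?_
          rw [← lintegral_const_mul _ (by fun_prop)]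
          refine (lintegral_mono fun y => two_mul_sum_gaussKernel_le ht x y).trans ?_
          rw [lintegral_add_left (by fun_prop)]
          simp
      _ = _ := by
          rw [lintegral_add_left (by fun_prop)]
          simp [two_mul]
  rw [ENNReal.mul_le_mul_iff_right (by simp) (by simp)] at h2
  refine h2.trans ?_
  simp_rw [sum_gaussKernel_eq]
  rw [lintegral_add_left (by fun_prop), lintegral_const_mul _ (by fun_prop)]
  simp

/-- A Schur test: the Gaussian self-energy of a density is controlled by its `L²` norm. -/
lemma lintegral_gaussKernel_le_sq {t : ℝ} (ht : 0 < t) {f : ℝ → ENNReal} (hf : AEMeasurable f) :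
    ∫⁻ a, ∫⁻ b, gaussKernel t (a - b) ∂(volume.withDensity f) ∂(volume.withDensity f) ≤
      ENNReal.ofReal (√Real.pi / t) * ∫⁻ x, f x ^ 2 := by
  have hK : ∀ x, ∫⁻ y, gaussKernel t (x - y) = ENNReal.ofReal (√Real.pi / t) := by
    intro x
    rw [← lintegral_gaussKernel ht, ← lintegral_sub_right_eq_self (gaussKernel t) x]
    exact lintegral_congr fun y => by rw [← gaussKernel_neg, neg_sub]
  have hK' : ∀ y, ∫⁻ x, gaussKernel t (x - y) = ENNReal.ofReal (√Real.pi / t) := by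
    intro y
    rw [← lintegral_gaussKernel ht, lintegral_sub_right_eq_self (gaussKernel t) y]
  have hf1 : AEMeasurable (fun p : ℝ × ℝ => f p.1) (volume.prod volume) := hf.comp_fst
  have hf2 : AEMeasurable (fun p : ℝ × ℝ => f p.2) (volume.prod volume) := hf.comp_snd
  have hin : ∀ a, ∫⁻ b, gaussKernel t (a - b) ∂(volume.withDensity f) =
      ∫⁻ b, f b * gaussKernel t (a - b) :=
    fun a => lintegral_withDensity_eq_lintegral_mul₀ hf (by fun_prop)
  have hprod : ∫⁻ a, ∫⁻ b, gaussKernel t (a - b) ∂(volume.withDensity f) ∂(volume.withDensity f) =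
      ∫⁻ a, ∫⁻ b, f a * f b * gaussKernel t (a - b) := by
    rw [lintegral_withDensity_eq_lintegral_mul₀' hf
      (Measurable.lintegral_prod_right' (f := fun p : ℝ × ℝ => gaussKernel t (p.1 - p.2))
        (by fun_prop)).aemeasurable]
    refine lintegral_congr fun a => ?_
    simp only [Pi.mul_apply]
    rw [hin, ← lintegral_const_mul'' (f a) (f := fun b => f b * gaussKernel t (a - b)) (by fun_prop)]
    simp_rw [mul_assoc]
  -- by symmetry, `f a * f b` may be replaced by its bound `(f a ^ 2 + f b ^ 2) / 2`
  have key : 2 * ∫⁻ a, ∫⁻ b, f a * f b * gaussKernel t (a - b) ≤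
      2 * (ENNReal.ofReal (√Real.pi / t) * ∫⁻ x, f x ^ 2) := by
    have hm : AEMeasurable (fun p : ℝ × ℝ => gaussKernel t (p.1 - p.2)) (volume.prod volume) := by
      fun_prop
    have hA : ∫⁻ p : ℝ × ℝ, f p.1 ^ 2 * gaussKernel t (p.1 - p.2) =
        ENNReal.ofReal (√Real.pi / t) * ∫⁻ x, f x ^ 2 := by
      rw [Measure.volume_eq_prod, lintegral_prod _ (by fun_prop),
        ← lintegral_const_mul'' _ (f := fun x => f x ^ 2) (by fun_prop)]
      refine lintegral_congr fun x => ?_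
      dsimp only
      rw [lintegral_const_mul _ (by fun_prop), hK, mul_comm]
    have hB : ∫⁻ p : ℝ × ℝ, f p.2 ^ 2 * gaussKernel t (p.1 - p.2) =
        ENNReal.ofReal (√Real.pi / t) * ∫⁻ x, f x ^ 2 := by
      rw [Measure.volume_eq_prod, lintegral_prod_symm _ (by fun_prop),
        ← lintegral_const_mul'' _ (f := fun x => f x ^ 2) (by fun_prop)]
      refine lintegral_congr fun x => ?_
      dsimp only
      rw [lintegral_const_mul _ (by fun_prop), hK', mul_comm]
    rw [← lintegral_prod (fun p : ℝ × ℝ => f p.1 * f p.2 * gaussKernel t (p.1 - p.2))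
      (by fun_prop), ← lintegral_const_mul'' (2 : ENNReal) (f := fun p : ℝ × ℝ => f p.1 * f p.2 *
        gaussKernel t (p.1 - p.2)) (by fun_prop), two_mul]
    nth_rw 1 [← hA]
    rw [← hB, Measure.volume_eq_prod, ← lintegral_add_left' (by fun_prop)]
    refine lintegral_mono fun p => ?_
    dsimp only
    rw [← add_mul, ← mul_assoc]
    gcongr
    exact ENNReal.two_mul_mul_le_add_sq _ _
  rw [hprod]
  exact (ENNReal.mul_le_mul_iff_right (by simp) (by simp)).1 key

/-! ### The density as an intensity measure -/

/-- Insertion of the `i`-th coordinate preserves Lebesgue measure. -/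
lemma measurePreserving_insertCoord {N : ℕ} (i : Fin N) :
    MeasurePreserving (fun (p : ℝ × ({j : Fin N // j ≠ i} → ℝ)) (j : Fin N) =>
      if h : j = i then p.1 else p.2 ⟨j, h⟩) (volume.prod volume) volume := by
  have h1 : MeasurePreserving
      (MeasurableEquiv.piEquivPiSubtypeProd (fun _ : Fin N => ℝ) (fun j => j = i)).symm
      ((volume : Measure ({j : Fin N // j = i} → ℝ)).prod
        (volume : Measure ({j : Fin N // j ≠ i} → ℝ))) volume := by
    convert (volume_preserving_piEquivPiSubtypeProd (fun _ : Fin N => ℝ) (fun j => j = i)).symm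
    · rfl
    · rw [Measure.volume_eq_prod]
      congr!
  have h2 : MeasurePreserving (MeasurableEquiv.funUnique {j : Fin N // j = i} ℝ).symm
      volume volume := by
    convert (volume_preserving_funUnique {j : Fin N // j = i} ℝ).symm
  have h3 := h1.comp (h2.prod (MeasurePreserving.id (volume : Measure ({j : Fin N // j ≠ i} → ℝ))))
  refine ⟨?_, ?_⟩
  · refine measurable_pi_lambda _ fun j => ?_
    by_cases h : j = i
    · simp only [h, dite_true]; fun_prop
    · simp only [h, dite_false]; fun_prop
  · convert h3.map_eq using 2
    ext p j
    by_cases h : j = i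
    · subst h; simp [MeasurableEquiv.piEquivPiSubtypeProd, Equiv.piEquivPiSubtypeProd]
    · simp [MeasurableEquiv.piEquivPiSubtypeProd, Equiv.piEquivPiSubtypeProd, h]

/-- The one-particle density is the intensity measure of the random configuration with
law `|ψ|²`. -/
lemma withDensity_density_eq_sum_map {N : ℕ} {ψ : (Fin N → ℝ) → ℂ} (hψ : MemLp ψ 2 volume)
    (hd : AEMeasurable (density ψ)) :
    volume.withDensity (fun x => ENNReal.ofReal (density ψ x)) =
      ∑ i, (volume.withDensity fun x => ENNReal.ofReal (‖ψ x‖ ^ 2)).map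
        (fun x : Fin N → ℝ => x i) := by
  have hint : Integrable (fun x => ‖ψ x‖ ^ 2) := hψ.integrable_norm_pow (by norm_num)
  refine Measure.ext_of_lintegral _ fun f hf => ?_
  rw [lintegral_withDensity_eq_lintegral_mul₀ (by fun_prop) hf.aemeasurable,
    lintegral_finsetSum_measure]
  set T : (i : Fin N) → ℝ × ({j : Fin N // j ≠ i} → ℝ) → (Fin N → ℝ) := fun i p j =>
    if h : j = i then p.1 else p.2 ⟨j, h⟩ with hT
  have hTm : ∀ i, MeasurePreserving (T i) (volume.prod volume) volume :=
    measurePreserving_insertCoord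
  have hTint : ∀ i, Integrable (fun p => ‖ψ (T i p)‖ ^ 2) (volume.prod volume) :=
    fun i => (hTm i).integrable_comp_of_integrable hint
  -- the Bochner integrals in the definition of the density converge for almost every `a` only
  have hpt : ∀ᵐ a : ℝ, ENNReal.ofReal (density ψ a) =
      ∑ i, ∫⁻ y : {j : Fin N // j ≠ i} → ℝ, ENNReal.ofReal (‖ψ (T i (a, y))‖ ^ 2) := by
    have := ae_all_iff.2 fun i => (hTint i).prod_right_ae
    filter_upwards [this] with a ha
    rw [density, ENNReal.ofReal_sum_of_nonneg fun i _ => integral_nonneg fun y => by positivity]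
    exact Finset.sum_congr rfl fun i _ => ofReal_integral_eq_lintegral_ofReal (ha i)
      (Filter.Eventually.of_forall fun y => by positivity)
  have hTae : ∀ i, AEMeasurable (fun p => ENNReal.ofReal (‖ψ (T i p)‖ ^ 2))
      (volume.prod volume) := fun i => (hTint i).aemeasurable.ennreal_ofReal
  have hfi : ∀ i : Fin N, Measurable (fun x : Fin N → ℝ => f (x i)) :=
    fun i => hf.comp (measurable_pi_apply i)
  calc ∫⁻ a, ((fun x => ENNReal.ofReal (density ψ x)) * f) a
      = ∫⁻ a, ∑ i, ∫⁻ y : {j : Fin N // j ≠ i} → ℝ,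
          ENNReal.ofReal (‖ψ (T i (a, y))‖ ^ 2) * f a := by
        refine lintegral_congr_ae ?_
        have := ae_all_iff.2 fun i => (hTint i).prod_right_ae
        filter_upwards [hpt, this] with a ha hb
        rw [Pi.mul_apply, ha, Finset.sum_mul]
        exact Finset.sum_congr rfl fun i _ =>
          (lintegral_mul_const'' _ (hb i).aemeasurable.ennreal_ofReal).symm
    _ = ∑ i, ∫⁻ a, ∫⁻ y : {j : Fin N // j ≠ i} → ℝ,
          ENNReal.ofReal (‖ψ (T i (a, y))‖ ^ 2) * f a := by
        refine lintegral_finsetSum' _ fun i _ => ?_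
        exact AEMeasurable.lintegral_prod_right' (f := fun p : ℝ × ({j : Fin N // j ≠ i} → ℝ) =>
          ENNReal.ofReal (‖ψ (T i p)‖ ^ 2) * f p.1) ((hTae i).mul (by fun_prop))
    _ = _ := by
        refine Finset.sum_congr rfl fun i _ => ?_
        rw [lintegral_map hf (by fun_prop), lintegral_withDensity_eq_lintegral_mul₀
          hint.aemeasurable.ennreal_ofReal (hfi i).aemeasurable, ← (hTm i).map_eq,
          lintegral_map' ?_ (hTm i).measurable.aemeasurable]
        · rw [lintegral_prod]
          · simp [hT]
          · exact (hTae i).mul ((hfi i).comp (hTm i).measurable).aemeasurable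
        · rw [(hTm i).map_eq]
          exact hint.aemeasurable.ennreal_ofReal.mul (hfi i).aemeasurable

lemma density_nonneg {N : ℕ} (ψ : (Fin N → ℝ) → ℂ) (x : ℝ) : 0 ≤ density ψ x :=
  Finset.sum_nonneg fun _ _ => integral_nonneg fun _ => by positivity

/-- The density integrates to the number of particles. -/
lemma lintegral_density {N : ℕ} {ψ : (Fin N → ℝ) → ℂ} (hψ : MemLp ψ 2 volume)
    (hnorm : ∫ x : Fin N → ℝ, ‖ψ x‖ ^ 2 = 1) (hd : AEMeasurable (density ψ)) :
    ∫⁻ x, ENNReal.ofReal (density ψ x) = N := by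
  have h1 : ∫⁻ x, ENNReal.ofReal (‖ψ x‖ ^ 2) = 1 := by
    rw [← ofReal_integral_eq_lintegral_ofReal (hψ.integrable_norm_pow (by norm_num))
      (Filter.Eventually.of_forall fun _ => by positivity), hnorm, ENNReal.ofReal_one]
  have h := congrArg (fun ν => ν Set.univ) (withDensity_density_eq_sum_map hψ hd)
  simp only [withDensity_apply _ MeasurableSet.univ, Measure.restrict_univ, Measure.finsetSum_apply]
    at h
  rw [h]
  have : ∀ i, (Measure.map (fun x : Fin N → ℝ => x i)
      (volume.withDensity fun x => ENNReal.ofReal (‖ψ x‖ ^ 2))) Set.univ = 1 := by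
    intro i
    rw [Measure.map_apply (by fun_prop) MeasurableSet.univ, Set.preimage_univ,
      withDensity_apply _ MeasurableSet.univ, Measure.restrict_univ, h1]
  rw [Finset.sum_congr rfl fun i _ => this i]
  simp

lemma integrable_density {N : ℕ} {ψ : (Fin N → ℝ) → ℂ} (hψ : MemLp ψ 2 volume)
    (hnorm : ∫ x : Fin N → ℝ, ‖ψ x‖ ^ 2 = 1) (hd : AEMeasurable (density ψ)) :
    Integrable (density ψ) := by
  refine ⟨hd.aestronglyMeasurable, ?_⟩
  rw [hasFiniteIntegral_iff_ofReal (Filter.Eventually.of_forall (density_nonneg ψ)),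
    lintegral_density hψ hnorm hd]
  exact ENNReal.natCast_lt_top N

/-- The mean density is positive, so that it may be divided by. -/
lemma meanDensity_pos {N : ℕ} (hN : 1 ≤ N) {ψ : (Fin N → ℝ) → ℂ} (hψ : MemLp ψ 2 volume)
    (hnorm : ∫ x : Fin N → ℝ, ‖ψ x‖ ^ 2 = 1) (hρ : MemLp (density ψ) 2 volume) :
    0 < meanDensity ψ := by
  have hd := hρ.aestronglyMeasurable.aemeasurable
  have hN' : (0 : ℝ) < N := by exact_mod_cast hN
  refine mul_pos (by positivity) ?_
  refine lt_of_le_of_ne (integral_nonneg fun x => sq_nonneg _) fun h => ?_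
  have h0 := (integral_eq_zero_iff_of_nonneg (fun x => sq_nonneg (density ψ x))
    hρ.integrable_sq).1 h.symm
  have h1 := lintegral_density hψ hnorm hd
  rw [lintegral_congr_ae (g := fun _ => 0)] at h1
  · simp only [lintegral_zero] at h1
    have : N = 0 := by exact_mod_cast h1.symm
    omega
  · filter_upwards [h0] with x hx
    have : density ψ x = 0 := by simpa using hx
    simp [this]

/-! ### Landau functions and the weight of the Gaussians -/

/-- `1/√s` is the superposition of the Gaussians `e^{-t²s}` over `t > 0`. -/
lemma lintegral_Ioi_gaussian_eq {s : ℝ} (hs : 0 < s) :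
    ∫⁻ t in Set.Ioi (0 : ℝ), ENNReal.ofReal (2 / √Real.pi * Real.exp (-t ^ 2 * s)) =
      ENNReal.ofReal (1 / √s) := by
  have h := integral_gaussian_Ioi s
  have hi : IntegrableOn (fun t : ℝ => Real.exp (-s * t ^ 2)) (Set.Ioi 0) :=
    (integrable_exp_neg_mul_sq hs).integrableOn
  have h2 : ∀ t : ℝ, 2 / √Real.pi * Real.exp (-t ^ 2 * s) =
      2 / √Real.pi * Real.exp (-s * t ^ 2) := fun t => by ring_nf
  simp_rw [h2]
  rw [← ofReal_integral_eq_lintegral_ofReal (hi.const_mul _)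
    (Filter.Eventually.of_forall fun t => by positivity), integral_const_mul, h,
    Real.sqrt_div Real.pi_pos.le]
  congr 1
  have : 0 < √Real.pi := by positivity
  have : 0 < √s := by positivity
  field_simp

lemma norm_landauFunction_sq {B : ℝ} (hB : 0 < B) (m : ℕ) (w : ℂ) :
    ‖landauFunction B m w‖ ^ 2 =
      B / (2 * Real.pi) * ((B * ‖w‖ ^ 2 / 2) ^ m / m.factorial * Real.exp (-(B * ‖w‖ ^ 2 / 2))) := by
  have h1 : ‖Complex.exp (-Complex.I * (m : ℂ) * (Complex.arg w : ℂ))‖ = 1 := by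
    rw [show -Complex.I * (m : ℂ) * (Complex.arg w : ℂ) =
      ((-(m * Complex.arg w) : ℝ) : ℂ) * Complex.I by push_cast; ring, Complex.norm_exp_ofReal_mul_I]
  have h2 : ((B * ‖w‖ ^ 2 / 2) ^ ((m : ℝ) / 2)) ^ 2 = (B * ‖w‖ ^ 2 / 2) ^ m := by
    rw [← Real.rpow_natCast, ← Real.rpow_mul (by positivity)]
    simp
  have h3 : Real.exp (-B * ‖w‖ ^ 2 / 4) ^ 2 = Real.exp (-(B * ‖w‖ ^ 2 / 2)) := by
    rw [← Real.exp_nat_mul]; congr 1; push_cast; ring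
  rw [landauFunction, norm_mul, norm_mul, h1, mul_one, Complex.norm_real, Complex.norm_real,
    mul_pow, Real.norm_eq_abs, Real.norm_eq_abs, sq_abs, sq_abs, h3, mul_pow, mul_pow, h2, div_pow,
    Real.sq_sqrt (by positivity), Real.sq_sqrt (by positivity)]
  ring

@[fun_prop]
lemma measurable_landauFunction (B : ℝ) (m : ℕ) : Measurable (landauFunction B m) := by
  have := Complex.measurable_arg
  unfold landauFunction
  fun_prop

/-- The Landau densities are bounded by `B / 2π`, uniformly in `m`, since `uᵐ/m! ≤ eᵘ`. -/
lemma norm_landauFunction_sq_le {B : ℝ} (hB : 0 < B) (m : ℕ) (w : ℂ) :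
    ‖landauFunction B m w‖ ^ 2 ≤ B / (2 * Real.pi) := by
  rw [norm_landauFunction_sq hB]
  refine mul_le_of_le_one_right (by positivity) ?_
  rw [Real.exp_neg, ← div_eq_mul_inv, div_le_one (Real.exp_pos _)]
  exact Real.pow_div_factorial_le_exp _ (by positivity) m

/-- Gaussian moments in the plane. -/
lemma integrable_norm_pow_mul_exp {b : ℝ} (hb : 0 < b) (m : ℕ) :
    Integrable (fun w : ℂ => ‖w‖ ^ (2 * m) * Real.exp (-b * ‖w‖ ^ 2)) ∧
    ∫ w : ℂ, ‖w‖ ^ (2 * m) * Real.exp (-b * ‖w‖ ^ 2) =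
      Real.pi * m.factorial / b ^ (m + 1) := by
  have h := Complex.integral_rpow_mul_exp_neg_mul_rpow (p := 2) (q := (2 * m : ℕ)) (b := b)
    (by norm_num) (lt_of_lt_of_le (by norm_num) (Nat.cast_nonneg _)) hb
  have e1 : ((2 * m : ℕ) + 2 : ℝ) / 2 = (m : ℝ) + 1 := by push_cast; ring
  have e2 : -((2 * m : ℕ) + 2 : ℝ) / 2 = -((m + 1 : ℕ) : ℝ) := by push_cast; ring
  rw [e1, e2, Real.Gamma_nat_eq_factorial, Real.rpow_neg hb.le, Real.rpow_natCast] at h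
  simp_rw [Real.rpow_natCast, Real.rpow_two] at h
  have h' : ∫ w : ℂ, ‖w‖ ^ (2 * m) * Real.exp (-b * ‖w‖ ^ 2) =
      Real.pi * m.factorial / b ^ (m + 1) := by rw [h]; field_simp
  refine ⟨?_, h'⟩
  -- the integral is nonzero, so it is not the junk value of a divergent integral
  by_contra hn
  rw [integral_undef hn] at h'
  have : 0 < Real.pi * m.factorial / b ^ (m + 1) := by positivity
  linarith

/-- The Landau functions are normalized. -/
lemma lintegral_norm_landauFunction_sq {B : ℝ} (hB : 0 < B) (m : ℕ) :
    ∫⁻ w, ENNReal.ofReal (‖landauFunction B m w‖ ^ 2) = 1 := by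
  obtain ⟨hi, hv⟩ := integrable_norm_pow_mul_exp (half_pos hB) m
  have e : ∀ w, ‖landauFunction B m w‖ ^ 2 = B / (2 * Real.pi) * (B / 2) ^ m / m.factorial *
      (‖w‖ ^ (2 * m) * Real.exp (-(B / 2) * ‖w‖ ^ 2)) := by
    intro w
    rw [norm_landauFunction_sq hB, show B * ‖w‖ ^ 2 / 2 = B / 2 * ‖w‖ ^ 2 by ring, mul_pow,
      ← pow_mul, neg_mul]
    ring
  simp_rw [e]
  rw [← ofReal_integral_eq_lintegral_ofReal (hi.const_mul _)
    (Filter.Eventually.of_forall fun t => by positivity), integral_const_mul, hv]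
  rw [ENNReal.ofReal_eq_one]
  have := Real.pi_pos
  rw [pow_succ]
  field_simp

lemma lintegral_gaussKernel_norm {t : ℝ} (ht : 0 < t) (x : ℂ) :
    ∫⁻ y : ℂ, gaussKernel t ‖x - y‖ = ENNReal.ofReal (Real.pi / t ^ 2) := by
  obtain ⟨hi, hv⟩ := integrable_norm_pow_mul_exp (pow_pos ht 2) 0
  simp only [mul_zero, pow_zero, one_mul, Nat.factorial_zero, Nat.cast_one, mul_one, zero_add,
    pow_one] at hi hv
  rw [← hv, ofReal_integral_eq_lintegral_ofReal hi
    (Filter.Eventually.of_forall fun t => by positivity),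
    ← lintegral_sub_right_eq_self (fun y : ℂ => ENNReal.ofReal (Real.exp (-t ^ 2 * ‖y‖ ^ 2))) x]
  exact lintegral_congr fun y => by rw [gaussKernel, norm_sub_rev]

/-- The Gaussian self-energy, at inverse length `t`, of the planar density `|φ_m|²`. -/
noncomputable def landauGauss (B : ℝ) (m : ℕ) (t : ℝ) : ENNReal :=
  ∫⁻ p : ℂ × ℂ, ENNReal.ofReal (‖landauFunction B m p.1‖ ^ 2 * ‖landauFunction B m p.2‖ ^ 2) *
    gaussKernel t ‖p.1 - p.2‖

/-- The weight with which the Gaussian `e^{-t²z²}` enters the effective potential `V_{m,m}(z)`. -/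
noncomputable def landauWeight (B : ℝ) (m : ℕ) (t : ℝ) : ENNReal :=
  ENNReal.ofReal (2 / √Real.pi) * landauGauss B m t

lemma measurable_landauWeight (B : ℝ) (m : ℕ) : Measurable (landauWeight B m) := by
  refine Measurable.const_mul (Measurable.lintegral_prod_right' (f := fun q : ℝ × (ℂ × ℂ) =>
    ENNReal.ofReal (‖landauFunction B m q.2.1‖ ^ 2 * ‖landauFunction B m q.2.2‖ ^ 2) *
      gaussKernel q.1 ‖q.2.1 - q.2.2‖) ?_) _
  fun_prop

/-- One of the two densities integrates to `1`, so it suffices to bound the Gaussian potential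
generated by the other. -/
lemma landauGauss_le {B : ℝ} (hB : 0 < B) (m : ℕ) {t : ℝ} {c : ENNReal}
    (hc : ∀ x, ∫⁻ y, ENNReal.ofReal (‖landauFunction B m y‖ ^ 2) * gaussKernel t ‖x - y‖ ≤ c) :
    landauGauss B m t ≤ c := by
  rw [landauGauss, Measure.volume_eq_prod, lintegral_prod _
    (by fun_prop)]
  calc _ ≤ ∫⁻ x, ENNReal.ofReal (‖landauFunction B m x‖ ^ 2) * c := by
        refine lintegral_mono fun x => ?_
        simp_rw [ENNReal.ofReal_mul (sq_nonneg ‖landauFunction B m x‖), mul_assoc]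
        rw [lintegral_const_mul _ (by fun_prop)]
        gcongr
        exact hc x
    _ = c := by
        rw [lintegral_mul_const _ (by fun_prop), lintegral_norm_landauFunction_sq hB, one_mul]

lemma landauGauss_le_one {B : ℝ} (hB : 0 < B) (m : ℕ) (t : ℝ) : landauGauss B m t ≤ 1 := by
  refine landauGauss_le hB m fun x => ?_
  rw [← lintegral_norm_landauFunction_sq hB m]
  exact lintegral_mono fun y => mul_le_of_le_one_right' (gaussKernel_le_one _ _)

lemma landauGauss_le_div_sq {B : ℝ} (hB : 0 < B) (m : ℕ) {t : ℝ} (ht : 0 < t) :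
    landauGauss B m t ≤ ENNReal.ofReal (B / (2 * t ^ 2)) := by
  refine landauGauss_le hB m fun x => ?_
  calc _ ≤ ∫⁻ y, ENNReal.ofReal (B / (2 * Real.pi)) * gaussKernel t ‖x - y‖ :=
        lintegral_mono fun y => by
          gcongr
          exact norm_landauFunction_sq_le hB m y
    _ = _ := by
        rw [lintegral_const_mul _ (by fun_prop), lintegral_gaussKernel_norm ht,
          ← ENNReal.ofReal_mul (by positivity)]
        congr 1
        have := Real.pi_pos
        field_simp

lemma lintegral_landauPotentialIntegrand (B : ℝ) (m : ℕ) (z : ℝ) :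
    ∫⁻ p, ENNReal.ofReal (landauPotentialIntegrand B m m z p) =
      ∫⁻ t in Set.Ioi (0 : ℝ), landauWeight B m t * gaussKernel t z := by
  set F : ℂ × ℂ → ENNReal := fun p =>
    ENNReal.ofReal (‖landauFunction B m p.1‖ ^ 2 * ‖landauFunction B m p.2‖ ^ 2) with hF
  have hFm : Measurable F := by fun_prop
  -- the diagonal, where the Coulomb kernel takes the junk value `1 / 0 = 0`, is a null set
  have hdiag : ∀ᵐ p : ℂ × ℂ, p.1 ≠ p.2 := by
    rw [Measure.volume_eq_prod, Measure.ae_prod_iff_ae_ae]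
    · refine Filter.Eventually.of_forall fun x => ?_
      filter_upwards [Measure.ae_ne volume x] with y hy using hy.symm
    · exact (measurableSet_eq_fun measurable_fst measurable_snd).compl
  calc ∫⁻ p, ENNReal.ofReal (landauPotentialIntegrand B m m z p)
      = ∫⁻ p, ∫⁻ t in Set.Ioi (0 : ℝ), F p * (ENNReal.ofReal (2 / √Real.pi) *
          (gaussKernel t ‖p.1 - p.2‖ * gaussKernel t z)) := by
        refine lintegral_congr_ae ?_
        filter_upwards [hdiag] with p hp
        have hpos : 0 < ‖p.1 - p.2‖ ^ 2 + z ^ 2 := by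
          have := norm_pos_iff.2 (sub_ne_zero.2 hp)
          positivity
        rw [lintegral_const_mul _ (by fun_prop), landauPotentialIntegrand, div_eq_mul_one_div,
          ENNReal.ofReal_mul (by positivity), ← lintegral_Ioi_gaussian_eq hpos]
        congr 1
        refine lintegral_congr fun t => ?_
        rw [gaussKernel, gaussKernel, ← ENNReal.ofReal_mul (Real.exp_pos _).le, ← Real.exp_add,
          ← ENNReal.ofReal_mul (by positivity), mul_add]
    _ = ∫⁻ t in Set.Ioi (0 : ℝ), ∫⁻ p, F p * (ENNReal.ofReal (2 / √Real.pi) *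
          (gaussKernel t ‖p.1 - p.2‖ * gaussKernel t z)) :=
        lintegral_lintegral_swap (by unfold Function.uncurry; fun_prop)
    _ = _ := by
        refine lintegral_congr fun t => ?_
        rw [landauWeight, landauGauss, mul_assoc, ← lintegral_mul_const _ (by fun_prop),
          ← lintegral_const_mul _ (by fun_prop)]
        exact lintegral_congr fun p => by ring

lemma lintegral_Ioi_inv_pow {a : ℝ} (ha : 0 < a) {n : ℕ} (hn : 1 ≤ n) :
    ∫⁻ t in Set.Ioi a, ENNReal.ofReal (1 / t ^ (n + 1)) = ENNReal.ofReal (1 / (n * a ^ n)) := by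
  have hlt : (-((n + 1 : ℕ) : ℝ)) < -1 := by
    have : (1 : ℝ) ≤ n := by exact_mod_cast hn
    push_cast; linarith
  have hi := integrableOn_Ioi_rpow_of_lt hlt ha
  have hv := integral_Ioi_rpow_of_lt hlt ha
  have e : ∀ t ∈ Set.Ioi a, ENNReal.ofReal (1 / t ^ (n + 1)) =
      ENNReal.ofReal (t ^ (-((n + 1 : ℕ) : ℝ))) := by
    intro t ht
    rw [Real.rpow_neg (ha.trans ht).le, Real.rpow_natCast, one_div]
  rw [setLIntegral_congr_fun measurableSet_Ioi e, ← ofReal_integral_eq_lintegral_ofReal hi, hv]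
  · rw [show (-((n + 1 : ℕ) : ℝ)) + 1 = -(n : ℝ) by push_cast; ring, Real.rpow_neg ha.le,
      Real.rpow_natCast]
    congr 1
    field_simp
  · filter_upwards [ae_restrict_mem measurableSet_Ioi] with t ht
    exact Real.rpow_nonneg (ha.trans ht).le _

lemma lintegral_landauWeight_lt_top {B : ℝ} (hB : 0 < B) (m : ℕ) :
    ∫⁻ t in Set.Ioi (0 : ℝ), landauWeight B m t < ⊤ := by
  have h : ∫⁻ t in Set.Ioi (0 : ℝ), landauGauss B m t < ⊤ := by
    rw [← Set.Ioc_union_Ioi_eq_Ioi zero_le_one]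
    refine (lintegral_union_le _ _ _).trans_lt (ENNReal.add_lt_top.2 ⟨?_, ?_⟩)
    · calc _ ≤ ∫⁻ t in Set.Ioc (0 : ℝ) 1, 1 := lintegral_mono fun t => landauGauss_le_one hB m t
        _ < ⊤ := by simp
    · calc _ ≤ ∫⁻ t in Set.Ioi (1 : ℝ), ENNReal.ofReal (B / 2) * ENNReal.ofReal (1 / t ^ (1 + 1)) := by
            refine setLIntegral_mono (by fun_prop) fun t ht => ?_
            refine (landauGauss_le_div_sq hB m (zero_lt_one.trans ht)).trans_eq ?_
            rw [← ENNReal.ofReal_mul (by positivity)]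
            congr 1
            ring
        _ < ⊤ := by
            rw [lintegral_const_mul _ (by fun_prop), lintegral_Ioi_inv_pow one_pos le_rfl]
            exact ENNReal.mul_lt_top ENNReal.ofReal_lt_top ENNReal.ofReal_lt_top
  have e : ∫⁻ t in Set.Ioi (0 : ℝ), landauWeight B m t =
      ENNReal.ofReal (2 / √Real.pi) * ∫⁻ t in Set.Ioi (0 : ℝ), landauGauss B m t :=
    lintegral_const_mul' _ _ ENNReal.ofReal_ne_top
  rw [e]
  exact ENNReal.mul_lt_top ENNReal.ofReal_lt_top h

lemma integrable_landauPotentialIntegrand {B : ℝ} (hB : 0 < B) (m : ℕ) (z : ℝ) :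
    Integrable (landauPotentialIntegrand B m m z) := by
  have hm : Measurable (landauPotentialIntegrand B m m z) := by
    unfold landauPotentialIntegrand
    fun_prop
  refine ⟨hm.aestronglyMeasurable, ?_⟩
  rw [hasFiniteIntegral_iff_ofReal (Filter.Eventually.of_forall fun p => by
    simp only [landauPotentialIntegrand, Pi.zero_apply]; positivity),
    lintegral_landauPotentialIntegrand]
  refine lt_of_le_of_lt (lintegral_mono fun t => ?_) (lintegral_landauWeight_lt_top hB m)
  exact mul_le_of_le_one_right' (gaussKernel_le_one _ _)

/-- The effective potential is a superposition of Gaussians with nonnegative weights. -/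
lemma ofReal_landauPotential {B : ℝ} (hB : 0 < B) (m : ℕ) (z : ℝ) :
    ENNReal.ofReal (landauPotential B m m z) =
      ∫⁻ t in Set.Ioi (0 : ℝ), landauWeight B m t * gaussKernel t z := by
  rw [← lintegral_landauPotentialIntegrand, landauPotential,
    ofReal_integral_eq_lintegral_ofReal (integrable_landauPotentialIntegrand hB m z)]
  exact Filter.Eventually.of_forall fun p => by
    simp only [landauPotentialIntegrand, Pi.zero_apply]; positivity

lemma landauPotential_nonneg (B : ℝ) (m : ℕ) (z : ℝ) : 0 ≤ landauPotential B m m z :=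
  integral_nonneg fun p => by simp only [landauPotentialIntegrand, Pi.zero_apply]; positivity

lemma measurable_lintegral_landauWeight (B : ℝ) (m : ℕ) : Measurable fun z =>
    ∫⁻ t in Set.Ioi (0 : ℝ), landauWeight B m t * gaussKernel t z := by
  have := measurable_landauWeight B m
  exact Measurable.lintegral_prod_right' (ν := volume.restrict (Set.Ioi (0 : ℝ)))
    (f := fun q : ℝ × ℝ => landauWeight B m q.2 * gaussKernel q.2 q.1) (by fun_prop)

lemma measurable_landauPotential {B : ℝ} (hB : 0 < B) (m : ℕ) :
    Measurable (landauPotential B m m) := by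
  have h : landauPotential B m m = fun z =>
      (∫⁻ t in Set.Ioi (0 : ℝ), landauWeight B m t * gaussKernel t z).toReal := by
    ext z
    rw [← ofReal_landauPotential hB, ENNReal.toReal_ofReal (landauPotential_nonneg _ _ _)]
  rw [h]
  exact (measurable_lintegral_landauWeight B m).ennreal_toReal

lemma norm_landauPotential_le {B : ℝ} (hB : 0 < B) (m : ℕ) (z : ℝ) :
    ‖landauPotential B m m z‖ ≤ (∫⁻ t in Set.Ioi (0 : ℝ), landauWeight B m t).toReal := by
  rw [Real.norm_of_nonneg (landauPotential_nonneg _ _ _),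
    ← ENNReal.ofReal_le_iff_le_toReal (lintegral_landauWeight_lt_top hB m).ne,
    ofReal_landauPotential hB]
  exact lintegral_mono fun t => mul_le_of_le_one_right' (gaussKernel_le_one _ _)

/-! ### Interaction and direct energy as superpositions of Gaussian energies -/

lemma integrable_interactionIntegrand {N : ℕ} {V : ℝ → ℝ} (hV : Measurable V) {C : ℝ}
    (hC : ∀ z, ‖V z‖ ≤ C) {ψ : (Fin N → ℝ) → ℂ} (hψ : MemLp ψ 2 volume) :
    Integrable (interactionIntegrand V ψ) := by
  have hint : Integrable (fun x => ‖ψ x‖ ^ 2) := hψ.integrable_norm_pow (by norm_num)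
  unfold interactionIntegrand
  simp_rw [Finset.sum_mul]
  refine integrable_finsetSum _ fun i _ => integrable_finsetSum _ fun j _ => ?_
  exact hint.bdd_mul (c := C)
    (hV.comp (by fun_prop : Measurable fun x : Fin N → ℝ => |x i - x j|)).aestronglyMeasurable
    (Filter.Eventually.of_forall fun x => hC _)

lemma integrable_directIntegrand {N : ℕ} {V : ℝ → ℝ} (hV : Measurable V) {C : ℝ}
    (hC : ∀ z, ‖V z‖ ≤ C) {ψ : (Fin N → ℝ) → ℂ} (hd : Integrable (density ψ)) :
    Integrable (directIntegrand V ψ) :=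
  (hd.mul_prod hd).mul_bdd (c := C)
    (hV.comp (by fun_prop : Measurable fun p : ℝ × ℝ => |p.1 - p.2|)).aestronglyMeasurable
    (Filter.Eventually.of_forall fun x => hC _)

lemma lintegral_interactionIntegrand {B : ℝ} (hB : 0 < B) (m : ℕ) {N : ℕ} {ψ : (Fin N → ℝ) → ℂ}
    (hψ : AEMeasurable ψ) :
    ∫⁻ x, ENNReal.ofReal (interactionIntegrand (landauPotential B m m) ψ x) =
      ∫⁻ t in Set.Ioi (0 : ℝ), landauWeight B m t *
        ∫⁻ x, ∑ i, ∑ j ∈ Finset.Ioi i, gaussKernel t (x i - x j)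
          ∂(volume.withDensity fun x : Fin N → ℝ => ENNReal.ofReal (‖ψ x‖ ^ 2)) := by
  have hw := measurable_landauWeight B m
  have hP : AEMeasurable fun x => ENNReal.ofReal (‖ψ x‖ ^ 2) := by fun_prop
  set μ := volume.withDensity fun x : Fin N → ℝ => ENNReal.ofReal (‖ψ x‖ ^ 2)
  have h1 : ∀ x, ENNReal.ofReal (interactionIntegrand (landauPotential B m m) ψ x) =
      ENNReal.ofReal (‖ψ x‖ ^ 2) * ∫⁻ t in Set.Ioi (0 : ℝ), landauWeight B m t *
        ∑ i, ∑ j ∈ Finset.Ioi i, gaussKernel t (x i - x j) := by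
    intro x
    have hnn : ∀ i, 0 ≤ ∑ j ∈ Finset.Ioi i, landauPotential B m m |x i - x j| :=
      fun i => Finset.sum_nonneg fun j _ => landauPotential_nonneg _ _ _
    rw [interactionIntegrand, mul_comm, ENNReal.ofReal_mul (by positivity),
      ENNReal.ofReal_sum_of_nonneg fun i _ => hnn i]
    congr 1
    simp_rw [Finset.mul_sum]
    rw [lintegral_finsetSum _ fun i _ => by fun_prop]
    refine Finset.sum_congr rfl fun i _ => ?_
    rw [lintegral_finsetSum _ fun i _ => by fun_prop,
      ENNReal.ofReal_sum_of_nonneg fun j _ => landauPotential_nonneg _ _ _]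
    refine Finset.sum_congr rfl fun j _ => ?_
    rw [ofReal_landauPotential hB]
    simp only [gaussKernel, sq_abs]
  simp_rw [h1]
  have hm : Measurable fun q : (Fin N → ℝ) × ℝ => landauWeight B m q.2 *
      ∑ i, ∑ j ∈ Finset.Ioi i, gaussKernel q.2 (q.1 i - q.1 j) := by fun_prop
  calc _ = ∫⁻ x, (∫⁻ t in Set.Ioi (0 : ℝ), landauWeight B m t *
        ∑ i, ∑ j ∈ Finset.Ioi i, gaussKernel t (x i - x j)) ∂μ :=
        (lintegral_withDensity_eq_lintegral_mul₀ hP hm.lintegral_prod_right'.aemeasurable).symm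
    _ = ∫⁻ t in Set.Ioi (0 : ℝ), ∫⁻ x, landauWeight B m t *
        ∑ i, ∑ j ∈ Finset.Ioi i, gaussKernel t (x i - x j) ∂μ :=
        lintegral_lintegral_swap hm.aemeasurable
    _ = _ := lintegral_congr fun t => lintegral_const_mul _ (by fun_prop)

lemma lintegral_directIntegrand {B : ℝ} (hB : 0 < B) (m : ℕ) {N : ℕ} {ψ : (Fin N → ℝ) → ℂ}
    (hd : AEMeasurable (density ψ)) :
    ∫⁻ p, ENNReal.ofReal (directIntegrand (landauPotential B m m) ψ p) =
      ∫⁻ t in Set.Ioi (0 : ℝ), landauWeight B m t *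
        ∫⁻ a, ∫⁻ b, gaussKernel t (a - b)
          ∂(volume.withDensity fun x => ENNReal.ofReal (density ψ x))
          ∂(volume.withDensity fun x => ENNReal.ofReal (density ψ x)) := by
  have hw := measurable_landauWeight B m
  set f := fun x => ENNReal.ofReal (density ψ x) with hf
  have hfm : AEMeasurable f := by fun_prop
  set σ := volume.withDensity f
  set U : ℝ → ENNReal := fun z =>
    ∫⁻ t in Set.Ioi (0 : ℝ), landauWeight B m t * gaussKernel t z with hU
  have hUm : Measurable U := measurable_lintegral_landauWeight B m
  have h1 : ∀ p, ENNReal.ofReal (directIntegrand (landauPotential B m m) ψ p) =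
      f p.1 * (f p.2 * U (p.1 - p.2)) := by
    intro p
    rw [directIntegrand, mul_assoc, ENNReal.ofReal_mul (density_nonneg _ _),
      ENNReal.ofReal_mul (density_nonneg _ _), ofReal_landauPotential hB]
    simp only [hf, hU, gaussKernel, sq_abs]
  have hf1 : AEMeasurable (fun p : ℝ × ℝ => f p.1) (volume.prod volume) := hfm.comp_fst
  have hf2 : AEMeasurable (fun p : ℝ × ℝ => f p.2) (volume.prod volume) := hfm.comp_snd
  have hU2 : Measurable fun p : ℝ × ℝ => U (p.1 - p.2) := hUm.comp (by fun_prop)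
  have hm : Measurable fun q : (ℝ × ℝ) × ℝ => landauWeight B m q.2 *
      gaussKernel q.2 (q.1.1 - q.1.2) := by fun_prop
  simp_rw [h1]
  calc _ = ∫⁻ a, ∫⁻ b, f a * (f b * U (a - b)) := by
        rw [Measure.volume_eq_prod]
        exact lintegral_prod _ (hf1.mul (hf2.mul hU2.aemeasurable))
    _ = ∫⁻ a, f a * ∫⁻ b, U (a - b) ∂σ := by
        refine lintegral_congr fun a => ?_
        have hUa : AEMeasurable fun b => U (a - b) :=
          (hUm.comp (by fun_prop : Measurable fun b => a - b)).aemeasurable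
        rw [lintegral_withDensity_eq_lintegral_mul₀ hfm hUa]
        exact lintegral_const_mul'' _ (hfm.mul hUa)
    _ = ∫⁻ a, ∫⁻ b, U (a - b) ∂σ ∂σ :=
        (lintegral_withDensity_eq_lintegral_mul₀ hfm
          hU2.lintegral_prod_right'.aemeasurable).symm
    _ = ∫⁻ p, U (p.1 - p.2) ∂(σ.prod σ) :=
        (lintegral_prod (fun p : ℝ × ℝ => U (p.1 - p.2)) hU2.aemeasurable).symm
    _ = ∫⁻ t in Set.Ioi (0 : ℝ), ∫⁻ p, landauWeight B m t * gaussKernel t (p.1 - p.2)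
          ∂(σ.prod σ) := lintegral_lintegral_swap hm.aemeasurable
    _ = _ := by
        refine lintegral_congr fun t => ?_
        rw [lintegral_const_mul _ (by fun_prop), lintegral_prod _ (by fun_prop)]

/-! ### The exchange energy -/

lemma lintegral_Ioc_one_div {a b : ℝ} (ha : 0 < a) (hab : a ≤ b) :
    ∫⁻ t in Set.Ioc a b, ENNReal.ofReal (1 / t) = ENNReal.ofReal (Real.log (b / a)) := by
  have h0 : (0 : ℝ) ∉ Set.uIcc a b := by
    rw [Set.uIcc_of_le hab]; exact fun h => absurd h.1 (not_le.2 ha)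
  have hi : IntervalIntegrable (fun t : ℝ => 1 / t) volume a b :=
    intervalIntegral.intervalIntegrable_one_div (fun t ht h => h0 (h ▸ ht)) continuousOn_id
  rw [← integral_one_div h0, intervalIntegral.integral_of_le hab,
    ofReal_integral_eq_lintegral_ofReal ((intervalIntegrable_iff_integrableOn_Ioc_of_le hab).1 hi)]
  filter_upwards [ae_restrict_mem measurableSet_Ioc] with t ht
  have := ha.trans ht.1
  simp only [Pi.zero_apply]
  positivity

/-- The total error made in comparing self-energies: below `t = r` it is bounded by the number of
particles, above by the `L²` norm of the density, and the decay of the weight on the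
scale `√B` cuts off the logarithmic divergence of the latter. -/
lemma lintegral_landauWeight_mul_min_le {B : ℝ} (hB : 0 < B) (m N : ℕ) {r : ℝ} (hr : 0 < r) :
    ∫⁻ t in Set.Ioi (0 : ℝ), landauWeight B m t *
        min (N : ENNReal) (ENNReal.ofReal (√Real.pi / t * (N * r))) ≤
      ENNReal.ofReal (2 * (N * r) * (Real.log (1 + √B / r) + 2)) := by
  set b := r + √B with hb
  have hsB : 0 < √B := Real.sqrt_pos.2 hB
  have hrb : r ≤ b := by linarith
  have hpi : 1 ≤ √Real.pi := Real.one_le_sqrt.2 (by linarith [Real.two_le_pi])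
  have hL : 0 ≤ Real.log (b / r) := Real.log_nonneg (by rw [le_div_iff₀ hr]; linarith)
  have I1 : ∫⁻ t in Set.Ioc (0 : ℝ) r, landauWeight B m t *
      min (N : ENNReal) (ENNReal.ofReal (√Real.pi / t * (N * r))) ≤
      ENNReal.ofReal (2 * (N * r)) := by
    calc _ ≤ ∫⁻ t in Set.Ioc (0 : ℝ) r, ENNReal.ofReal (2 / √Real.pi * N) := by
          refine lintegral_mono fun t => ?_
          rw [ENNReal.ofReal_mul (p := 2 / √Real.pi) (by positivity), ENNReal.ofReal_natCast]
          exact mul_le_mul' (mul_le_of_le_one_right' (landauGauss_le_one hB m t)) (min_le_left _ _)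
      _ = ENNReal.ofReal (2 / √Real.pi * N * r) := by
          rw [setLIntegral_const, Real.volume_Ioc, sub_zero, ← ENNReal.ofReal_mul (by positivity)]
      _ ≤ _ := by
          refine ENNReal.ofReal_le_ofReal ?_
          rw [mul_assoc]
          gcongr
          exact div_le_self (by norm_num) hpi
  have I2 : ∫⁻ t in Set.Ioc r b, landauWeight B m t *
      min (N : ENNReal) (ENNReal.ofReal (√Real.pi / t * (N * r))) ≤
      ENNReal.ofReal (2 * (N * r) * Real.log (b / r)) := by
    calc _ ≤ ∫⁻ t in Set.Ioc r b, ENNReal.ofReal (2 * (N * r)) * ENNReal.ofReal (1 / t) := by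
          refine setLIntegral_mono (by fun_prop) fun t ht => ?_
          have ht0 : 0 < t := hr.trans ht.1
          calc _ ≤ ENNReal.ofReal (2 / √Real.pi) * ENNReal.ofReal (√Real.pi / t * (N * r)) :=
                mul_le_mul' (mul_le_of_le_one_right' (landauGauss_le_one hB m t))
                  (min_le_right _ _)
            _ = _ := by
                rw [← ENNReal.ofReal_mul (by positivity), ← ENNReal.ofReal_mul (by positivity)]
                congr 1
                field_simp
      _ = _ := by
          rw [lintegral_const_mul _ (by fun_prop), lintegral_Ioc_one_div hr hrb,
            ← ENNReal.ofReal_mul (by positivity)]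
  have I3 : ∫⁻ t in Set.Ioi b, landauWeight B m t *
      min (N : ENNReal) (ENNReal.ofReal (√Real.pi / t * (N * r))) ≤
      ENNReal.ofReal (2 * (N * r)) := by
    calc _ ≤ ∫⁻ t in Set.Ioi b, ENNReal.ofReal (N * r * B) * ENNReal.ofReal (1 / t ^ (2 + 1)) := by
          refine setLIntegral_mono (by fun_prop) fun t ht => ?_
          have ht0 : 0 < t := (hr.trans_le hrb).trans ht
          calc _ ≤ ENNReal.ofReal (2 / √Real.pi) * ENNReal.ofReal (B / (2 * t ^ 2)) *
                ENNReal.ofReal (√Real.pi / t * (N * r)) :=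
                mul_le_mul' (mul_le_mul_right (landauGauss_le_div_sq hB m ht0) _)
                  (min_le_right _ _)
            _ = _ := by
                rw [← ENNReal.ofReal_mul (by positivity), ← ENNReal.ofReal_mul (by positivity),
                  ← ENNReal.ofReal_mul (by positivity)]
                congr 1
                field_simp
                ring
      _ = ENNReal.ofReal (N * r * B * (1 / (2 * b ^ 2))) := by
          rw [lintegral_const_mul _ (by fun_prop),
            lintegral_Ioi_inv_pow (hr.trans_le hrb) (by norm_num),
            ← ENNReal.ofReal_mul (by positivity)]
          norm_num
      _ ≤ _ := by
          refine ENNReal.ofReal_le_ofReal ?_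
          have hBb : B ≤ b ^ 2 := by
            nlinarith [Real.sq_sqrt hB.le]
          have : B * (1 / (2 * b ^ 2)) ≤ 2 := by
            rw [mul_one_div, div_le_iff₀ (by positivity)]
            nlinarith [sq_nonneg b]
          calc _ = N * r * (B * (1 / (2 * b ^ 2))) := by ring
            _ ≤ N * r * 2 := by gcongr
            _ = _ := by ring
  rw [← Set.Ioc_union_Ioi_eq_Ioi hr.le, ← Set.Ioc_union_Ioi_eq_Ioi hrb]
  refine (lintegral_union_le _ _ _).trans ((add_le_add I1
    ((lintegral_union_le _ _ _).trans (add_le_add I2 I3))).trans_eq ?_)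
  rw [← ENNReal.ofReal_add (by positivity) (by positivity),
    ← ENNReal.ofReal_add (by positivity) (by positivity)]
  have : 1 + √B / r = b / r := by rw [hb]; field_simp
  rw [this]
  congr 1
  ring

/-- The direct energy exceeds twice the interaction energy by at most the accumulated error of the
Gaussian comparisons. -/
lemma integral_directIntegrand_le {B : ℝ} (hB : 0 < B) (m : ℕ) {N : ℕ} (hN : 1 ≤ N)
    {ψ : (Fin N → ℝ) → ℂ} (hψ : MemLp ψ 2 volume) (hnorm : ∫ x : Fin N → ℝ, ‖ψ x‖ ^ 2 = 1)
    (hρ : MemLp (density ψ) 2 volume)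
    (hI : Integrable (interactionIntegrand (landauPotential B m m) ψ))
    (hD : Integrable (directIntegrand (landauPotential B m m) ψ)) :
    ∫ p, directIntegrand (landauPotential B m m) ψ p ≤
      2 * (∫ x, interactionIntegrand (landauPotential B m m) ψ x) +
        2 * (N * meanDensity ψ) * (Real.log (1 + √B / meanDensity ψ) + 2) := by
  have hd := hρ.aestronglyMeasurable.aemeasurable
  have hψm := hψ.aestronglyMeasurable.aemeasurable
  have hr := meanDensity_pos hN hψ hnorm hρ
  have hN' : (0 : ℝ) < N := by exact_mod_cast hN
  have hw := measurable_landauWeight B m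
  set r := meanDensity ψ with hrdef
  set μ := volume.withDensity fun x : Fin N → ℝ => ENNReal.ofReal (‖ψ x‖ ^ 2) with hμ
  have : IsProbabilityMeasure μ := ⟨by
    rw [hμ, withDensity_apply _ MeasurableSet.univ, Measure.restrict_univ,
      ← ofReal_integral_eq_lintegral_ofReal (hψ.integrable_norm_pow (by norm_num))
      (Filter.Eventually.of_forall fun _ => by positivity), hnorm, ENNReal.ofReal_one]⟩
  have hsq : ∫⁻ x, ENNReal.ofReal (density ψ x) ^ 2 = ENNReal.ofReal (N * r) := by
    have : N * r = ∫ x, density ψ x ^ 2 := by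
      rw [hrdef, meanDensity]
      field_simp
    rw [this, ofReal_integral_eq_lintegral_ofReal hρ.integrable_sq
      (Filter.Eventually.of_forall fun _ => sq_nonneg _)]
    exact lintegral_congr fun x => (ENNReal.ofReal_pow (density_nonneg _ _) 2).symm
  have hD0 : ∀ p, 0 ≤ directIntegrand (landauPotential B m m) ψ p := fun p =>
    mul_nonneg (mul_nonneg (density_nonneg _ _) (density_nonneg _ _)) (landauPotential_nonneg _ _ _)
  have hI0 : ∀ x, 0 ≤ interactionIntegrand (landauPotential B m m) ψ x := fun x =>
    mul_nonneg (Finset.sum_nonneg fun i _ => Finset.sum_nonneg fun j _ =>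
      landauPotential_nonneg _ _ _) (sq_nonneg _)
  have hL : 0 ≤ Real.log (1 + √B / r) := Real.log_nonneg (by
    have : 0 ≤ √B / r := by positivity
    linarith)
  have hIi := integral_nonneg (μ := volume) (f := interactionIntegrand (landauPotential B m m) ψ) hI0
  rw [← ENNReal.ofReal_le_ofReal_iff (by positivity), ENNReal.ofReal_add (by positivity)
    (by positivity), ENNReal.ofReal_mul (by norm_num), ENNReal.ofReal_ofNat,
    ofReal_integral_eq_lintegral_ofReal hD (Filter.Eventually.of_forall hD0),
    ofReal_integral_eq_lintegral_ofReal hI (Filter.Eventually.of_forall hI0),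
    lintegral_directIntegrand hB m hd, lintegral_interactionIntegrand hB m hψm, ← hμ]
  set A : ℝ → ENNReal := fun t =>
    ∫⁻ x, ∑ i, ∑ j ∈ Finset.Ioi i, gaussKernel t (x i - x j) ∂μ with hA
  have hAm : Measurable A := Measurable.lintegral_prod_right'
    (f := fun q : ℝ × (Fin N → ℝ) => ∑ i, ∑ j ∈ Finset.Ioi i, gaussKernel q.1 (q.2 i - q.2 j))
    (by fun_prop)
  refine le_trans ?_ (add_le_add_right (lintegral_landauWeight_mul_min_le hB m N hr) _)
  rw [← lintegral_const_mul _ (by fun_prop), ← lintegral_add_left (by fun_prop)]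
  refine setLIntegral_mono (by fun_prop) fun t ht => ?_
  have hmin := lintegral_gaussKernel_marginals_le ht μ (withDensity_density_eq_sum_map hψ hd)
  have hsch := lintegral_gaussKernel_le_sq ht (f := fun x => ENNReal.ofReal (density ψ x))
    (by fun_prop)
  rw [hsq, ← ENNReal.ofReal_mul (by have : (0 : ℝ) < t := ht; positivity)] at hsch
  rw [mul_left_comm, ← mul_add]
  gcongr
  rw [← min_add_add_left]
  exact le_min hmin (hsch.trans le_add_self)

theorem mainTheorem1 (B : ℝ) (hB : 0 < B) (m : ℕ) (N : ℕ) (hN : 1 ≤ N)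
    (ψ : (Fin N → ℝ) → ℂ) (hψ : MemLp ψ 2 volume)
    (hnorm : ∫ x : Fin N → ℝ, ‖ψ x‖ ^ 2 = 1)
    (hρ : MemLp (density ψ) 2 volume) :
    (∀ z : ℝ, Integrable (landauPotentialIntegrand B m m z) volume) ∧
    Integrable (interactionIntegrand (landauPotential B m m) ψ) volume ∧
    Integrable (directIntegrand (landauPotential B m m) ψ) volume ∧
    exchangeEnergy (landauPotential B m m) ψ ≥
      -16 * (N : ℝ) * meanDensity ψ *
        (Real.log (Real.exp 3 + √B / meanDensity ψ) + 2) := by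
  have hd := hρ.aestronglyMeasurable.aemeasurable
  have hV := measurable_landauPotential hB m
  have hI := integrable_interactionIntegrand hV (norm_landauPotential_le hB m) hψ
  have hD := integrable_directIntegrand hV (norm_landauPotential_le hB m)
    (integrable_density hψ hnorm hd)
  refine ⟨integrable_landauPotentialIntegrand hB m, hI, hD, ?_⟩
  have hr := meanDensity_pos hN hψ hnorm hρ
  have key := integral_directIntegrand_le hB m hN hψ hnorm hρ hI hD
  have hs : 0 ≤ √B / meanDensity ψ := by positivity
  have hL0 : 0 ≤ Real.log (1 + √B / meanDensity ψ) := Real.log_nonneg (by linarith)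
  have hL : Real.log (1 + √B / meanDensity ψ) ≤ Real.log (Real.exp 3 + √B / meanDensity ψ) :=
    Real.log_le_log (by linarith) (by linarith [Real.one_le_exp (show (0 : ℝ) ≤ 3 by norm_num)])
  have hNr : 0 ≤ N * meanDensity ψ := by positivity
  have h1 := mul_le_mul_of_nonneg_left hL hNr
  have h2 := mul_nonneg hNr hL0
  rw [exchangeEnergy]
  linarith
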